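/- Let $K$ be an algebraically closed field. For tensors $S\in K^{n_1,n_2,n_3}$ and $T\in K^{m_1,m_2,m_3}$ write $S\le T$ if there are matrices $A\in K^{n_1\times m_1}$, $B\in K^{n_2\times m_2}$, $C\in K^{n_3\times m_3}$ with $S_{i,j,k}=\sum_{a,b,c}A_{i,a}B_{j,b}C_{k,c}T_{a,b,c}$ for all $i,j,k$. Let $I_r\in K^{r,r,r}$ be the diagonal tensor, with $(I_r)_{i,i,i}=1$ and all other entries $0$, and let the subrank $\mathrm{Q}(T)$ be the largest $r\geq 0$ with $I_r\le T$. Let $T\oplus S$ denote the block-diagonal direct sum of tensors. A subset of $K^{n,n,n}$ is Zariski-open if its complement is the common zero set of finitely many polynomials in the $n^3$ entries. Theorem. Let $n\ge 1$. There are tensors $S,T\in K^{n,n,n}$ such that $T+S=I_n$, $\mathrm{Q}(T)\le\sqrt{3n-2}$, $\mathrm{Q}(S)\le\sqrt{3n-2}$ and $\mathrm{Q}(T\oplus S)\ge n$. Moreover, $T$ and $S$ can both be chosen generic, in the sense that for every non-empty Zariski-open subset $U\subseteq K^{n,n,n}$ there are such $S,T$ that both lie in $U$. Consequently the subrank is not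 additive under direct sum: there are $n$ and tensors $S,T\in K^{n,n,n}$ with $\mathrm{Q}(T)+\mathrm{Q}(S)<\mathrm{Q}(T\oplus S)$. -/

import Mathlib

namespace TensorSubrank

/-- The space of 3-tensors (three-dimensional arrays) over `K` with index sets `a`, `b`, `c`.
For `a = Fin n₁`, `b = Fin n₂`, `c = Fin n₃` this is `K^{n₁,n₂,n₃}`.
Addition is coordinate-wise. -/
abbrev Tensor (K a b c : Type*) : Type _ := a → b → c → K

/-- The restriction preorder `S ≤ T`: there are matrices `A`, `B`, `C` with
`S i j k = ∑ x y z, A i x * B j y * C k z * T x y z` for all `i j k`. -/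
def Restricts {K : Type*} [Field K] {a b c a' b' c' : Type*}
    [Fintype a'] [Fintype b'] [Fintype c']
    (S : Tensor K a b c) (T : Tensor K a' b' c') : Prop :=
  ∃ (A : Matrix a a' K) (B : Matrix b b' K) (C : Matrix c c' K),
    ∀ i j k, S i j k = ∑ x, ∑ y, ∑ z, A i x * B j y * C k z * T x y z

/-- The diagonal tensor `I_r`: ones on the diagonal entries `(i,i,i)`, zeros elsewhere. -/
def diagTensor (K : Type*) [Field K] (r : ℕ) : Tensor K (Fin r) (Fin r) (Fin r) :=
  fun i j k => if i = j ∧ j = k then 1 else 0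

/-- The subrank `Q(T)`: the largest `r` such that `I_r ≤ T`. The set is nonempty and bounded,
so the supremum is a maximum, see `subrank_isGreatest`. -/
noncomputable def subrank {K : Type*} [Field K] {a b c : Type*}
    [Fintype a] [Fintype b] [Fintype c] (T : Tensor K a b c) : ℕ :=
  sSup {r : ℕ | Restricts (diagTensor K r) T}

theorem le_card_of_restricts {K : Type*} [Field K] {a b c : Type*}
    [Fintype a] [Fintype b] [Fintype c] (T : Tensor K a b c) {r : ℕ}
    (h : Restricts (diagTensor K r) T) : r ≤ Fintype.card a := by
  obtain ⟨A, B, C, h⟩ := h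
  have hli : LinearIndependent K (fun i x => A i x : Fin r → a → K) := by
    rw [Fintype.linearIndependent_iff]
    intro g hg j
    have hg' : ∀ x, ∑ i, g i * A i x = 0 := by
      intro x
      have := congrFun hg x
      simpa [Finset.sum_apply] using this
    have h1 : ∑ i, g i * diagTensor K r i j j = g j := by
      simp [diagTensor]
    rw [← h1]
    calc ∑ i, g i * diagTensor K r i j j
        = ∑ i, ∑ x, (g i * A i x) * ∑ y, ∑ z, B j y * C j z * T x y z := by
          refine Finset.sum_congr rfl fun i _ => ?_
          rw [h i j j, Finset.mul_sum]
          refine Finset.sum_congr rfl fun x _ => ?_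
          rw [Finset.mul_sum, Finset.mul_sum]
          refine Finset.sum_congr rfl fun y _ => ?_
          rw [Finset.mul_sum, Finset.mul_sum]
          refine Finset.sum_congr rfl fun z _ => ?_
          ring
      _ = 0 := by
          rw [Finset.sum_comm]
          refine Finset.sum_eq_zero fun x _ => ?_
          rw [← Finset.sum_mul, hg' x, zero_mul]
  simpa using hli.fintype_card_le_finrank

theorem subrank_isGreatest {K : Type*} [Field K] {a b c : Type*}
    [Fintype a] [Fintype b] [Fintype c] (T : Tensor K a b c) :
    IsGreatest {r : ℕ | Restricts (diagTensor K r) T} (subrank T) := by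
  have hne : {r : ℕ | Restricts (diagTensor K r) T}.Nonempty :=
    ⟨0, 0, 0, 0, fun i => i.elim0⟩
  have hb : BddAbove {r : ℕ | Restricts (diagTensor K r) T} :=
    ⟨Fintype.card a, fun _ hr => le_card_of_restricts T hr⟩
  exact ⟨Nat.sSup_mem hne hb, fun _ hr => le_csSup hb hr⟩

/-- The direct sum `T ⊕ S`: the block-diagonal tensor with blocks `T` and `S`. The disjoint
union `Fin n ⊕ Fin m` plays the role of the index set `[n + m]`. -/
def directSum {K : Type*} [Field K] {a b c a' b' c' : Type*}
    (T : Tensor K a b c) (S : Tensor K a' b' c') : Tensor K (a ⊕ a') (b ⊕ b') (c ⊕ c')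
  | .inl i, .inl j, .inl k => T i j k
  | .inr i, .inr j, .inr k => S i j k
  | _, _, _ => 0

/-- A set of tensors is Zariski-open if its complement is the zero set of a finite collection of
polynomials in the tensor entries. -/
def IsZariskiOpen {K : Type*} [Field K] {a b c : Type*} (U : Set (Tensor K a b c)) : Prop :=
  ∃ F : Finset (MvPolynomial (a × b × c) K),
    Uᶜ = {T | ∀ f ∈ F, MvPolynomial.eval (fun p => T p.1 p.2.1 p.2.2) f = 0}

end TensorSubrank

open MvPolynomial

namespace TensorSubrank

/-! Adding the two blocks of `T ⊕ S` restricts it to `T + S`, so `T + S = I_n` forces `Q(T ⊕ S) ≥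
n`. It remains to split `I_n` into two generic tensors, since generic subrank has order `√n`.

The generic bound is a dimension count. If `I_r ≤ T`, invertible row operations make each of the
three matrices the identity on `r` chosen columns, and turn `I_r` into a sum of `r` rank-one tensors
(`Restricts.exists_isNormalForm`). The `r³` entries of `T` in the chosen subcube are then
polynomials in the remaining data. When `r² > 3n - 2` this leaves fewer than `n³` parameters, so
such `T` satisfy a nonzero polynomial relation (`exists_relation_of_restricts`). A nonzero
polynomial can be kept nonzero at both `T` and `I_n - T`. -/

/-! ### Algebraic dependence and polynomial parametrizations -/

/-- Polynomial maps into a space of larger dimension are not dominant. -/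
theorem exists_relation_of_card_lt {K : Type*} [Field K] {σ τ : Type} [Fintype σ] [Fintype τ]
    (h : Fintype.card σ < Fintype.card τ) (φ : τ → MvPolynomial σ K) :
    ∃ g : MvPolynomial τ K, g ≠ 0 ∧ ∀ v : σ → K, eval (fun t => eval v (φ t)) g = 0 := by
  have hφ : ¬ AlgebraicIndependent K φ := by
    intro hi
    have := hi.lift_cardinalMk_le_trdeg
    rw [MvPolynomial.trdeg_of_isDomain] at this
    simp only [Cardinal.mk_fintype, Cardinal.lift_natCast, Nat.cast_le] at this
    omega
  rw [algebraicIndependent_iff] at hφ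
  push Not at hφ
  obtain ⟨g, hg, hg0⟩ := hφ
  refine ⟨g, hg0, fun v => ?_⟩
  have := congrArg (eval v) hg
  rwa [map_zero, MvPolynomial.aeval_def, MvPolynomial.algebraMap_eq, eval_eval₂,
    show (eval v).comp (C : K →+* MvPolynomial σ K) = RingHom.id K by ext; simp] at this

/-- A family of polynomials whose members in `s` are the constants `f₀` and whose other members
are variables. -/
noncomputable def partialGeneric {K : Type*} [Field K] {ι σ : Type} (s : Set ι) (f₀ : ι → K)
    (u : {i // i ∉ s} → σ) (i : ι) : MvPolynomial σ K :=
  open Classical in if h : i ∈ s then C (f₀ i) else X (u ⟨i, h⟩)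

theorem eval_partialGeneric {K : Type*} [Field K] {ι σ : Type} {s : Set ι} {f₀ f : ι → K}
    {u : {i // i ∉ s} → σ} {v : σ → K} (hs : ∀ i ∈ s, f i = f₀ i) (hv : ∀ i, v (u i) = f i)
    (i : ι) : eval v (partialGeneric s f₀ u i) = f i := by
  unfold partialGeneric
  split_ifs with h
  · simp [hs i h]
  · simp [hv]

/-! ### Normal forms and parameter count -/

/-- A matrix with a right inverse has an invertible square submatrix of full height. -/
theorem exists_submatrix_mul_eq_one {K : Type*} [Field K] {n r : ℕ} {A : Matrix (Fin r) (Fin n) K}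
    {D : Matrix (Fin n) (Fin r) K} (h : A * D = 1) :
    ∃ (e : Fin r → Fin n) (G : Matrix (Fin r) (Fin r) K), Function.Injective e ∧
      G * A.submatrix id e = 1 := by
  have hspan : Submodule.span K (Set.range A.col) = ⊤ := by
    rw [← Matrix.range_mulVecLin, LinearMap.range_eq_top]
    intro v
    exact ⟨D.mulVec v, by simp [h]⟩
  obtain ⟨f, hf, -, hli⟩ := Submodule.exists_fun_fin_finrank_span_eq K (Set.range A.col)
  have hr : Module.finrank K (Submodule.span K (Set.range A.col)) = r := by
    rw [hspan]; simp
  revert f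
  rw [hr]
  intro f hf hli
  choose e he using hf
  have hcol : (A.submatrix id e).col = f := by
    ext i j; rw [← he]; rfl
  have hu : IsUnit (A.submatrix id e) := by
    rw [← Matrix.linearIndependent_cols_iff_isUnit, hcol]; exact hli
  obtain ⟨G, hG⟩ := hu.exists_left_inv
  refine ⟨e, G, fun i j hij => hli.injective ?_, hG⟩
  rw [← he, ← he, hij]

/-- `(M, N, P) · T = ∑ l, a_l ⊗ b_l ⊗ c_l` where `M`, `N`, `P` restrict to identity matrices on
the columns chosen by `e₁`, `e₂`, `e₃`, and where `a_l`, `b_l` have entry `1` at `p l`, `q l`. -/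
structure IsNormalForm {K : Type*} [Field K] {n r : ℕ} (e₁ e₂ e₃ : Fin r → Fin n)
    (p q : Fin r → Fin r) (T : Tensor K (Fin n) (Fin n) (Fin n))
    (M N P : Fin r × Fin n → K) (a b c : Fin r × Fin r → K) : Prop where
  left (i j : Fin r) : M (i, e₁ j) = if i = j then 1 else 0
  middle (i j : Fin r) : N (i, e₂ j) = if i = j then 1 else 0
  right (i j : Fin r) : P (i, e₃ j) = if i = j then 1 else 0
  norm_left (l : Fin r) : a (p l, l) = 1
  norm_middle (l : Fin r) : b (q l, l) = 1
  eq (i j k : Fin r) : ∑ t : Fin n × Fin n × Fin n,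
    M (i, t.1) * N (j, t.2.1) * P (k, t.2.2) * T t.1 t.2.1 t.2.2 =
      ∑ l, a (i, l) * b (j, l) * c (k, l)

/-- The indices of entries in the chosen columns. -/
def pivotCols {n r : ℕ} (e : Fin r → Fin n) : Set (Fin r × Fin n) :=
  {x | x.2 ∈ Set.range e}

/-- The indices of entries of an `r × r` matrix normalized to one, one in each column. -/
def normEntries {r : ℕ} (p : Fin r → Fin r) : Set (Fin r × Fin r) :=
  {x | x.1 = p x.2}

/-- The indices of the entries in the chosen subcube of a tensor. -/
def pivotCube {n r : ℕ} (e₁ e₂ e₃ : Fin r → Fin n) : Set (Fin n × Fin n × Fin n) :=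
  Set.range fun x : Fin r × Fin r × Fin r => (e₁ x.1, e₂ x.2.1, e₃ x.2.2)

/-- The index type of free parameters of a normal form. -/
abbrev Param {n r : ℕ} (e₁ e₂ e₃ : Fin r → Fin n) (p q : Fin r → Fin r) : Type :=
  ({x // x ∉ pivotCols e₁} ⊕ {x // x ∉ pivotCols e₂} ⊕ {x // x ∉ pivotCols e₃}) ⊕
    ({x // x ∉ normEntries p} ⊕ {x // x ∉ normEntries q} ⊕ (Fin r × Fin r)) ⊕
    {t // t ∉ pivotCube e₁ e₂ e₃}

theorem natCard_compl_pivotCols {n r : ℕ} {e : Fin r → Fin n} (he : Function.Injective e) :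
    Nat.card {x // x ∉ pivotCols e} + r * r = r * n := by
  have h := Set.ncard_add_ncard_compl (pivotCols e)
  have h1 : pivotCols e = Set.univ ×ˢ Set.range e := by ext; simp [pivotCols]
  have h2 : (pivotCols e).ncard = r * r := by
    rw [h1, Set.ncard_prod, Set.ncard_univ, ← Set.image_univ, Set.ncard_image_of_injective _ he,
      Set.ncard_univ]
    simp
  rw [h2, Nat.card_prod, Nat.card_fin, Nat.card_fin] at h
  rw [← h, add_comm]; rfl

theorem natCard_compl_normEntries {r : ℕ} (p : Fin r → Fin r) :
    Nat.card {x // x ∉ normEntries p} + r = r * r := by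
  have h := Set.ncard_add_ncard_compl (normEntries p)
  have h1 : normEntries p = (fun l => (p l, l)) '' Set.univ := by
    ext ⟨i, l⟩; simp [normEntries, eq_comm]
  have h2 : (normEntries p).ncard = r := by
    rw [h1, Set.ncard_image_of_injective _ (fun i j h => (Prod.ext_iff.1 h).2), Set.ncard_univ]
    simp
  rw [h2, Nat.card_prod, Nat.card_fin] at h
  rw [← h, add_comm]; rfl

theorem natCard_compl_pivotCube {n r : ℕ} {e₁ e₂ e₃ : Fin r → Fin n}
    (h₁ : Function.Injective e₁) (h₂ : Function.Injective e₂) (h₃ : Function.Injective e₃) :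
    Nat.card {x // x ∉ pivotCube e₁ e₂ e₃} + r * (r * r) = n * (n * n) := by
  have h := Set.ncard_add_ncard_compl (pivotCube e₁ e₂ e₃)
  have h2 : (pivotCube e₁ e₂ e₃).ncard = r * (r * r) := by
    rw [pivotCube, ← Set.image_univ, Set.ncard_image_of_injective, Set.ncard_univ]
    · simp
    · rintro ⟨i, j, k⟩ ⟨i', j', k'⟩ hh
      simp only [Prod.mk.injEq] at hh ⊢
      exact ⟨h₁ hh.1, h₂ hh.2.1, h₃ hh.2.2⟩
  rw [h2] at h
  simp only [Nat.card_prod, Nat.card_fin] at h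
  rw [← h, add_comm]; rfl

/-- The count is `3r(n - r) + (3r² - 2r) + (n³ - r³) = n³ - r(r² + 2 - 3n)`. Normalizing two factors
of each rank-one term saves the `2r`. -/
theorem natCard_param_lt {n r : ℕ} {e₁ e₂ e₃ : Fin r → Fin n} (p q : Fin r → Fin r)
    (h₁ : Function.Injective e₁) (h₂ : Function.Injective e₂) (h₃ : Function.Injective e₃)
    (hr : 0 < r) (hnr : 3 * n < r * r + 2) :
    Nat.card (Param e₁ e₂ e₃ p q) < Nat.card (Fin n × Fin n × Fin n) := by
  have c1 := natCard_compl_pivotCols h₁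
  have c2 := natCard_compl_pivotCols h₂
  have c3 := natCard_compl_pivotCols h₃
  have c4 := natCard_compl_normEntries p
  have c5 := natCard_compl_normEntries q
  have c6 := natCard_compl_pivotCube h₁ h₂ h₃
  have key : r * (3 * n) < r * (r * r + 2) := Nat.mul_lt_mul_of_pos_left hnr hr
  have k1 : r * (3 * n) = 3 * (r * n) := by ring
  have k2 : r * (r * r + 2) = r * (r * r) + 2 * r := by ring
  simp only [Param, Nat.card_sum, Nat.card_prod, Nat.card_fin]
  omega

/-- Tensors admitting a normal form with prescribed discrete data satisfy a polynomial relation. -/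
theorem exists_relation_of_isNormalForm (K : Type*) [Field K] {n r : ℕ} {e₁ e₂ e₃ : Fin r → Fin n}
    (p q : Fin r → Fin r)
    (h₁ : Function.Injective e₁) (h₂ : Function.Injective e₂) (h₃ : Function.Injective e₃)
    (hr : 0 < r) (hnr : 3 * n < r * r + 2) :
    ∃ g : MvPolynomial (Fin n × Fin n × Fin n) K, g ≠ 0 ∧ ∀ T M N P a b c,
      IsNormalForm e₁ e₂ e₃ p q T M N P a b c → eval (fun t => T t.1 t.2.1 t.2.2) g = 0 := by
  classical
  let σ := Param e₁ e₂ e₃ p q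
  have : Fintype σ := Fintype.ofFinite σ
  let δ (e : Fin r → Fin n) : Fin r × Fin n → K := fun x => if e x.1 = x.2 then 1 else 0
  let M : Fin r × Fin n → MvPolynomial σ K :=
    partialGeneric (pivotCols e₁) (δ e₁) (Sum.inl ∘ Sum.inl)
  let N : Fin r × Fin n → MvPolynomial σ K :=
    partialGeneric (pivotCols e₂) (δ e₂) (Sum.inl ∘ Sum.inr ∘ Sum.inl)
  let P : Fin r × Fin n → MvPolynomial σ K :=
    partialGeneric (pivotCols e₃) (δ e₃) (Sum.inl ∘ Sum.inr ∘ Sum.inr)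
  let a : Fin r × Fin r → MvPolynomial σ K :=
    partialGeneric (normEntries p) 1 (Sum.inr ∘ Sum.inl ∘ Sum.inl)
  let b : Fin r × Fin r → MvPolynomial σ K :=
    partialGeneric (normEntries q) 1 (Sum.inr ∘ Sum.inl ∘ Sum.inr ∘ Sum.inl)
  let c : Fin r × Fin r → MvPolynomial σ K :=
    fun x => X (Sum.inr (Sum.inl (Sum.inr (Sum.inr x))))
  -- `R` is `T` with its subcube zeroed. Identity pivots let each subcube entry occur alone in one
  -- equation of `IsNormalForm.eq`; `B` solves for it.
  let R : Fin n × Fin n × Fin n → MvPolynomial σ K :=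
    partialGeneric (pivotCube e₁ e₂ e₃) 0 (Sum.inr ∘ Sum.inr)
  let B (x : Fin r × Fin r × Fin r) : MvPolynomial σ K :=
    ∑ l, a (x.1, l) * b (x.2.1, l) * c (x.2.2, l) -
      ∑ t : Fin n × Fin n × Fin n, M (x.1, t.1) * N (x.2.1, t.2.1) * P (x.2.2, t.2.2) * R t
  let φ (t : Fin n × Fin n × Fin n) : MvPolynomial σ K :=
    if h : t ∈ pivotCube e₁ e₂ e₃ then B h.choose else R t
  obtain ⟨g, hg, hg0⟩ := exists_relation_of_card_lt
    (by simpa only [Nat.card_eq_fintype_card] using natCard_param_lt p q h₁ h₂ h₃ hr hnr) φ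
  refine ⟨g, hg, fun T M' N' P' a' b' c' H => ?_⟩
  let v : σ → K := Sum.elim (Sum.elim (fun x => M' x) (Sum.elim (fun x => N' x) (fun x => P' x)))
    (Sum.elim (Sum.elim (fun x => a' x) (Sum.elim (fun x => b' x) c'))
      (fun t => T t.1.1 t.1.2.1 t.1.2.2))
  let R' : Fin n × Fin n × Fin n → K :=
    fun t => if t ∈ pivotCube e₁ e₂ e₃ then 0 else T t.1 t.2.1 t.2.2
  have hM : ∀ x, eval v (M x) = M' x := eval_partialGeneric
    (by rintro ⟨i, -⟩ ⟨j, rfl⟩; simp [δ, H.left, h₁.eq_iff]) (fun _ => rfl)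
  have hN : ∀ x, eval v (N x) = N' x := eval_partialGeneric
    (by rintro ⟨i, -⟩ ⟨j, rfl⟩; simp [δ, H.middle, h₂.eq_iff]) (fun _ => rfl)
  have hP : ∀ x, eval v (P x) = P' x := eval_partialGeneric
    (by rintro ⟨i, -⟩ ⟨j, rfl⟩; simp [δ, H.right, h₃.eq_iff]) (fun _ => rfl)
  have ha : ∀ x, eval v (a x) = a' x := eval_partialGeneric
    (by rintro ⟨i, l⟩ (rfl : i = p l); simp [H.norm_left]) (fun _ => rfl)
  have hb : ∀ x, eval v (b x) = b' x := eval_partialGeneric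
    (by rintro ⟨i, l⟩ (rfl : i = q l); simp [H.norm_middle]) (fun _ => rfl)
  have hc : ∀ x, eval v (c x) = c' x := fun x => by simp [c, v]
  have hR : ∀ t, eval v (R t) = R' t := eval_partialGeneric
    (by intro t ht; simp [R', ht]) (fun t => by simp [R', v, t.2])
  have hB : ∀ x, eval v (B x) = T (e₁ x.1) (e₂ x.2.1) (e₃ x.2.2) := by
    rintro ⟨i, j, k⟩
    simp only [B, map_sub, map_sum, map_mul, hM, hN, hP, ha, hb, hc, hR]
    rw [← H.eq, ← Finset.sum_sub_distrib, Finset.sum_eq_single (e₁ i, e₂ j, e₃ k)]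
    · have : (e₁ i, e₂ j, e₃ k) ∈ pivotCube e₁ e₂ e₃ := ⟨(i, j, k), rfl⟩
      simp [R', this, H.left, H.middle, H.right]
    · intro t _ ht
      by_cases htc : t ∈ pivotCube e₁ e₂ e₃
      · obtain ⟨⟨i', j', k'⟩, rfl⟩ := htc
        have : ¬ (i = i' ∧ j = j' ∧ k = k') := by
          rintro ⟨rfl, rfl, rfl⟩; exact ht rfl
        simp only [H.left, H.middle, H.right]
        split_ifs <;> simp_all
      · simp [R', htc]
    · simp
  have hφ : (fun t => eval v (φ t)) = fun t => T t.1 t.2.1 t.2.2 := by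
    funext t
    by_cases ht : t ∈ pivotCube e₁ e₂ e₃
    · simp only [φ, dif_pos ht]
      exact (hB _).trans (congrArg (fun s => T s.1 s.2.1 s.2.2) ht.choose_spec)
    · simp only [φ, dif_neg ht, hR, R', if_neg ht]
  rw [← hφ]
  exact hg0 v

theorem exists_ne_zero_of_mul_eq_one {K : Type*} [Field K] {r : ℕ}
    {G A : Matrix (Fin r) (Fin r) K} (h : G * A = 1) (l : Fin r) : ∃ i, G i l ≠ 0 := by
  by_contra! hG
  have := congrFun (congrFun (mul_eq_one_comm.1 h : A * G = 1) l) l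
  simp [Matrix.mul_apply, hG] at this

/-- A tensor that restricts to `I_r` has a normal form. -/
theorem Restricts.exists_isNormalForm {K : Type*} [Field K] {n r : ℕ}
    {T : Tensor K (Fin n) (Fin n) (Fin n)} (h : Restricts (diagTensor K r) T) :
    ∃ e₁ e₂ e₃ : Fin r → Fin n, Function.Injective e₁ ∧ Function.Injective e₂ ∧
      Function.Injective e₃ ∧ ∃ p q M N P a b c, IsNormalForm e₁ e₂ e₃ p q T M N P a b c := by
  obtain ⟨A, B, C, h⟩ := h
  obtain ⟨e₁, G₁, h₁, hG₁⟩ := exists_submatrix_mul_eq_one (A := A)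
    -- Setting two indices of `I_r` equal gives the identity matrix, so contracting `T` with the
    -- other two matrices yields a right inverse.
    (D := .of fun x j => ∑ y, ∑ z, B j y * C j z * T x y z) (by
      ext i j
      have := h i j j
      simp only [diagTensor, and_true] at this
      rw [Matrix.one_apply, this, Matrix.mul_apply]
      simp only [Matrix.of_apply, Finset.mul_sum, mul_assoc])
  obtain ⟨e₂, G₂, h₂, hG₂⟩ := exists_submatrix_mul_eq_one (A := B)
    (D := .of fun y j => ∑ x, ∑ z, A j x * C j z * T x y z) (by
      ext i j
      have := h j i j
      rw [Finset.sum_comm] at this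
      rw [Matrix.one_apply, Matrix.mul_apply]
      symm
      trans diagTensor K r j i j
      · simp only [diagTensor]
        congr 1
        grind
      · rw [this]
        simp only [Matrix.of_apply, Finset.mul_sum]
        congr! 3
        ring)
  obtain ⟨e₃, G₃, h₃, hG₃⟩ := exists_submatrix_mul_eq_one (A := C)
    (D := .of fun z j => ∑ x, ∑ y, A j x * B j y * T x y z) (by
      ext i j
      rw [Matrix.one_apply, Matrix.mul_apply]
      symm
      trans diagTensor K r j j i
      · simp only [diagTensor]
        congr 1
        grind
      · rw [h]
        simp only [Matrix.of_apply, Finset.mul_sum]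
        rw [Finset.sum_congr rfl fun x _ => Finset.sum_comm, Finset.sum_comm]
        congr! 3
        ring)
  choose p hp using exists_ne_zero_of_mul_eq_one hG₁
  choose q hq using exists_ne_zero_of_mul_eq_one hG₂
  have one_apply (i j : Fin r) : (1 : Matrix (Fin r) (Fin r) K) i j = if i = j then 1 else 0 :=
    Matrix.one_apply
  -- `(G₁, G₂, G₃)` sends `I_r` to the sum of tensor products of their `l`-th columns. The scalars
  -- divided out of the first two factors move into the third.
  refine ⟨e₁, e₂, e₃, h₁, h₂, h₃, p, q, fun x => (G₁ * A) x.1 x.2, fun x => (G₂ * B) x.1 x.2,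
    fun x => (G₃ * C) x.1 x.2, fun x => G₁ x.1 x.2 / G₁ (p x.2) x.2,
    fun x => G₂ x.1 x.2 / G₂ (q x.2) x.2,
    fun x => G₃ x.1 x.2 * (G₁ (p x.2) x.2 * G₂ (q x.2) x.2), ?_⟩
  constructor
  · intro i j; rw [← one_apply, ← hG₁]; rfl
  · intro i j; rw [← one_apply, ← hG₂]; rfl
  · intro i j; rw [← one_apply, ← hG₃]; rfl
  · intro l; exact div_self (hp l)
  · intro l; exact div_self (hq l)
  · intro i j k
    have h' (l : Fin r × Fin r × Fin r) :
        ∑ t : Fin n × Fin n × Fin n, A l.1 t.1 * B l.2.1 t.2.1 * C l.2.2 t.2.2 * T t.1 t.2.1 t.2.2 =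
          diagTensor K r l.1 l.2.1 l.2.2 := by
      rw [h]; simp only [Fintype.sum_prod_type]
    trans ∑ l : Fin r × Fin r × Fin r,
      G₁ i l.1 * G₂ j l.2.1 * G₃ k l.2.2 * diagTensor K r l.1 l.2.1 l.2.2
    · simp_rw [← h', Finset.mul_sum]
      rw [Finset.sum_comm]
      refine Finset.sum_congr rfl fun t _ => ?_
      simp only [Matrix.mul_apply, Fintype.sum_prod_type, Finset.sum_mul]
      refine Finset.sum_congr rfl fun l _ => ?_
      simp only [Finset.mul_sum, Finset.sum_mul]
      rw [Finset.sum_comm]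
      congr! 2
      ring
    · simp only [Fintype.sum_prod_type, diagTensor]
      refine Finset.sum_congr rfl fun l _ => ?_
      rw [Finset.sum_eq_single l, Finset.sum_eq_single l]
      · have := hp l
        have := hq l
        simp only [and_self, if_true]
        field_simp
      · intro m _ hm; simp [hm.symm]
      · simp
      · intro m _ hm; simp [hm.symm]
      · simp

/-! ### The generic subrank bound -/

/-- Tensors of subrank at least `r` satisfy a polynomial relation as soon as `r ^ 2 > 3 n - 2`. -/
theorem exists_relation_of_restricts (K : Type*) [Field K] {n r : ℕ}
    (hr : 0 < r) (hnr : 3 * n < r * r + 2) :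
    ∃ g : MvPolynomial (Fin n × Fin n × Fin n) K, g ≠ 0 ∧ ∀ T,
      Restricts (diagTensor K r) T → eval (fun t => T t.1 t.2.1 t.2.2) g = 0 := by
  choose g hg hg0 using fun x : (Fin r ↪ Fin n) × (Fin r ↪ Fin n) × (Fin r ↪ Fin n) ×
    (Fin r → Fin r) × (Fin r → Fin r) => exists_relation_of_isNormalForm K x.2.2.2.1 x.2.2.2.2
      x.1.injective x.2.1.injective x.2.2.1.injective hr hnr
  -- There are finitely many choices of discrete data, so the product of their relations covers
  -- every normal form.
  refine ⟨∏ x, g x, Finset.prod_ne_zero_iff.2 fun x _ => hg x, fun T hT => ?_⟩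
  obtain ⟨e₁, e₂, e₃, h₁, h₂, h₃, p, q, M, N, P, a, b, c, H⟩ := hT.exists_isNormalForm
  rw [map_prod]
  exact Finset.prod_eq_zero (Finset.mem_univ (⟨e₁, h₁⟩, ⟨e₂, h₂⟩, ⟨e₃, h₃⟩, p, q))
    (hg0 _ T M N P a b c H)

theorem restricts_diagTensor_mono {K : Type*} [Field K] {a b c : Type*} [Fintype a] [Fintype b]
    [Fintype c] {T : Tensor K a b c} {r s : ℕ} (hrs : r ≤ s) (h : Restricts (diagTensor K s) T) :
    Restricts (diagTensor K r) T := by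
  obtain ⟨A, B, C, h⟩ := h
  refine ⟨A.submatrix (Fin.castLE hrs) id, B.submatrix (Fin.castLE hrs) id,
    C.submatrix (Fin.castLE hrs) id, fun i j k => ?_⟩
  have := h (Fin.castLE hrs i) (Fin.castLE hrs j) (Fin.castLE hrs k)
  simpa [diagTensor] using this

/-- The subrank of a generic tensor is at most `√(3 n - 2)`. -/
theorem exists_ne_zero_subrank_le (K : Type*) [Field K] {n : ℕ} (hn : 1 ≤ n) :
    ∃ g : MvPolynomial (Fin n × Fin n × Fin n) K, g ≠ 0 ∧
      ∀ T : Tensor K (Fin n) (Fin n) (Fin n), eval (fun t => T t.1 t.2.1 t.2.2) g ≠ 0 →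
        (subrank T : ℝ) ≤ Real.sqrt (3 * (n : ℝ) - 2) := by
  have hlt := Nat.lt_succ_sqrt (3 * n - 2)
  obtain ⟨g, hg, hg0⟩ := exists_relation_of_restricts K (n := n)
    (r := (Nat.sqrt (3 * n - 2)).succ) (Nat.succ_pos _) (by omega)
  refine ⟨g, hg, fun T hT => ?_⟩
  have hle : subrank T ≤ Nat.sqrt (3 * n - 2) := by
    by_contra! hlt
    exact hT (hg0 T (restricts_diagTensor_mono hlt (subrank_isGreatest T).1))
  have hsq : subrank T ^ 2 ≤ 3 * n - 2 := Nat.le_sqrt'.1 hle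
  refine Real.le_sqrt_of_sq_le ?_
  -- `1 ≤ n` ensures that the subtraction `3 * n - 2` is not truncated.
  have : subrank T ^ 2 + 2 ≤ 3 * n := by omega
  have : ((subrank T ^ 2 + 2 : ℕ) : ℝ) ≤ (3 * n : ℕ) := by exact_mod_cast this
  push_cast at this
  linarith

/-! ### Generic splittings of the diagonal tensor -/

/-- A sum is a restriction of the direct sum. -/
theorem restricts_add_directSum {K : Type*} [Field K] {a b c : Type*} [Fintype a] [Fintype b]
    [Fintype c] (T S : Tensor K a b c) : Restricts (T + S) (directSum T S) := by
  classical
  refine ⟨.fromCols 1 1, .fromCols 1 1, .fromCols 1 1, fun i j k => ?_⟩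
  simp [directSum, Matrix.one_apply]

/-- A nonempty Zariski-open set contains the nonvanishing locus of a nonzero polynomial. -/
theorem IsZariskiOpen.exists_ne_zero {K : Type*} [Field K] {a b c : Type*}
    {U : Set (Tensor K a b c)} (hU : IsZariskiOpen U) (hne : U.Nonempty) :
    ∃ f : MvPolynomial (a × b × c) K, f ≠ 0 ∧
      ∀ T, eval (fun t => T t.1 t.2.1 t.2.2) f ≠ 0 → T ∈ U := by
  obtain ⟨F, hF⟩ := hU
  obtain ⟨T₀, hT₀⟩ := hne
  have h₀ : T₀ ∉ Uᶜ := fun h => h hT₀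
  rw [hF] at h₀
  simp only [Set.mem_ofPred_eq, not_forall] at h₀
  obtain ⟨f, hf, hf₀⟩ := h₀
  refine ⟨f, fun h => hf₀ (by simp [h]), fun T hT => ?_⟩
  by_contra hTU
  have : T ∈ Uᶜ := hTU
  rw [hF] at this
  exact hT (this f hf)

/-- Over an infinite field, for a nonzero polynomial `f` and a point `d` there is a point `x` such
that `f` vanishes neither at `x` nor at `d - x`. -/
theorem exists_eval_ne_zero_and_eval_sub_ne_zero {K : Type*} [Field K] [Infinite K] {τ : Type*}
    {f : MvPolynomial τ K} (hf : f ≠ 0) (d : τ → K) :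
    ∃ x : τ → K, eval x f ≠ 0 ∧ eval (d - x) f ≠ 0 := by
  let f' : MvPolynomial τ K := bind₁ (fun t => C (d t) - X t) f
  have hf' (x : τ → K) : eval x f' = eval (d - x) f := by
    simp only [f', eval, eval₂Hom_bind₁]
    congr 2
    funext t
    simp
  have exists_ne {h : MvPolynomial τ K} (hh : h ≠ 0) : ∃ x, eval x h ≠ 0 := by
    by_contra! H
    exact hh (MvPolynomial.funext fun x => by simp [H])
  -- The substitution `x ↦ d - x` is an involution, so it cannot kill `f`.
  have hf'0 : f' ≠ 0 := by
    obtain ⟨x, hx⟩ := exists_ne hf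
    intro h
    have := hf' (d - x)
    rw [h, sub_sub_cancel, map_zero] at this
    exact hx this.symm
  obtain ⟨x, hx⟩ := exists_ne (mul_ne_zero hf hf'0)
  rw [map_mul, hf'] at hx
  exact ⟨x, left_ne_zero_of_mul hx, right_ne_zero_of_mul hx⟩

theorem exists_generic_add_eq_diagTensor (K : Type*) [Field K] [Infinite K] {n : ℕ} (hn : 1 ≤ n)
    {U : Set (Tensor K (Fin n) (Fin n) (Fin n))} (hU : IsZariskiOpen U) (hne : U.Nonempty) :
    ∃ S ∈ U, ∃ T ∈ U, T + S = diagTensor K n ∧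
      (subrank T : ℝ) ≤ Real.sqrt (3 * (n : ℝ) - 2) ∧
      (subrank S : ℝ) ≤ Real.sqrt (3 * (n : ℝ) - 2) ∧ n ≤ subrank (directSum T S) := by
  obtain ⟨f, hf, hfU⟩ := hU.exists_ne_zero hne
  obtain ⟨g, hg, hgr⟩ := exists_ne_zero_subrank_le K hn
  obtain ⟨x, hx, hx'⟩ := exists_eval_ne_zero_and_eval_sub_ne_zero (mul_ne_zero hf hg)
    (fun t : Fin n × Fin n × Fin n => diagTensor K n t.1 t.2.1 t.2.2)
  rw [map_mul] at hx hx'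
  let T : Tensor K (Fin n) (Fin n) (Fin n) := fun i j k => x (i, j, k)
  have hTS : T + (diagTensor K n - T) = diagTensor K n := add_sub_cancel _ _
  refine ⟨diagTensor K n - T, hfU _ (left_ne_zero_of_mul hx'), T, hfU _ (left_ne_zero_of_mul hx),
    hTS, hgr _ (right_ne_zero_of_mul hx), hgr _ (right_ne_zero_of_mul hx'),
    (subrank_isGreatest _).2 ?_⟩
  have := restricts_add_directSum T (diagTensor K n - T)
  rwa [hTS] at this

end TensorSubrank

theorem theorem5p1 (K : Type*) [Field K] [IsAlgClosed K] :
    (∀ n : ℕ, 1 ≤ n →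
      ∀ U : Set (TensorSubrank.Tensor K (Fin n) (Fin n) (Fin n)),
        TensorSubrank.IsZariskiOpen U → U.Nonempty →
        ∃ S ∈ U, ∃ T ∈ U,
          T + S = TensorSubrank.diagTensor K n ∧
          (TensorSubrank.subrank T : ℝ) ≤ Real.sqrt (3 * (n : ℝ) - 2) ∧
          (TensorSubrank.subrank S : ℝ) ≤ Real.sqrt (3 * (n : ℝ) - 2) ∧
          n ≤ TensorSubrank.subrank (TensorSubrank.directSum T S)) ∧
    (∃ (n : ℕ) (S T : TensorSubrank.Tensor K (Fin n) (Fin n) (Fin n)),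
      TensorSubrank.subrank T + TensorSubrank.subrank S <
        TensorSubrank.subrank (TensorSubrank.directSum T S)) := by
  have : Infinite K := IsAlgClosed.instInfinite
  refine ⟨fun n hn U hU hne => TensorSubrank.exists_generic_add_eq_diagTensor K hn hU hne, ?_⟩
  -- For `n = 12` the bound is `√34 < 6`, so the two subranks sum to at most `10 < 12`. The whole
  -- space is open because the constant `1` has no zeros.
  obtain ⟨S, -, T, -, -, hT, hS, hTS⟩ := TensorSubrank.exists_generic_add_eq_diagTensor K
    (n := 12) (by norm_num) (U := Set.univ) ⟨{1}, by ext; simp⟩ Set.univ_nonempty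
  refine ⟨12, S, T, lt_of_lt_of_le ?_ hTS⟩
  have hsqrt : Real.sqrt (3 * ((12 : ℕ) : ℝ) - 2) < 6 := by
    rw [Real.sqrt_lt' (by norm_num)]
    norm_num
  have h₁ : TensorSubrank.subrank T < 6 := by exact_mod_cast hT.trans_lt hsqrt
  have h₂ : TensorSubrank.subrank S < 6 := by exact_mod_cast hS.trans_lt hsqrt
  omega
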